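/- Let $g\ge 1$ be an integer, $c_0,\dots,c_g$ indeterminates and $q>1$ a real number. For $k\ge 0$ let $V_k^{\pm}$ and $W_k^{\pm}$ be the matrices with $k+1$ and $k+2$ columns respectively, with $\lfloor (k+3)/2\rfloor$ rows for the sign $+$ and $\lfloor (k+2)/2\rfloor$ rows for the sign $-$, whose entry in row $i$ and column $j$ (both counted from $0$) is $1$ if $i=j$, is $\pm1$ if $i\neq j$ and $i+j=k+1$, and is $0$ otherwise. Define $$P_k(m)=\begin{bmatrix}V_k^+&0\\0&V_k^-\\ J_k&-mJ_k\end{bmatrix},\qquad Q_k=\begin{bmatrix}W_k^+&0\\0&W_k^-\\0&0\end{bmatrix},\qquad J_k=\begin{bmatrix}\mathbf 0_{k,1}& I_k\end{bmatrix},$$ of sizes $(2k+2)\times(2k+2)$ and $(2k+2)\times(2k+4)$. Let $v(0)$ be the column vector of length $4g+2$ with entries $c_0,\dots,c_{g-1},c_g,c_{g-1},\dots,c_0$ followed by $c_0\log(q^g),\dots,c_{g-1}\log q,\,0,\,-c_{g-1}\log q,\dots,-c_0\log(q^g)$. Writing $v[j]$ for the $j$-th entry of $v$, define for $n=1,\dots,2g$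 $$m_{2g-n}=\frac{v(n-1)[1]+v(n-1)[2g-n+2]}{v(n-1)[2g-n+3]-v(n-1)[4g-2n+4]},\qquad v(n)=P_{2g-n}(m_{2g-n})^{-1}Q_{2g-n}\,v(n-1),$$ and put $m_{2g}=1/(g\log q)$. Let $R_0=1$ and $$R_{2J+1}=\prod_{j=0}^{J}\frac{m_{2g-(2j+1)}}{m_{2g-2j}},\qquad R_{2J+2}=\prod_{j=0}^{J}\frac{m_{2g-(2j+2)}}{m_{2g-(2j+1)}}$$ for indices between $1$ and $2g$. Then each $R_n$ $(0\le n\le 2g)$ is a rational function in $\mathbb Q(c_0,\dots,c_g)$ which does not depend on $q$. Moreover, for every real vector $\underline c=(c_0,\dots,c_g)$ with $c_0\neq 0$, all zeros in $\mathbb C$ of the polynomial $$P_g(x)=\sum_{k=0}^{g-1}c_k\,(x^{2g-k}+x^k)+c_g x^g$$ lie on the unit circle $T=\{z\in\mathbb C: |z|=1\}$ and are simple if and only if, for every $1\le n\le 2g$, the rational functions $R_n$ and $R_n^{-1}$ are both defined at $\underline c$ and $$R_n(\underline c)>0\quad\text{and}\quad R_n(\underline c)^{-1}>0.$$ Here a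 rational function is called defined at $\underline c$ if it is a quotient of two polynomials the second of which does not vanish at $\underline c$. -/

import Mathlib

open Polynomial

namespace SelfReciprocal

noncomputable section

/-! ### The linear system

Rows and columns of the matrices below are counted from `0`; components of vectors are counted
from `1`, so that a vector of length `N` is a function `w : ℕ → K` of which only
`w 1, …, w N` are used. -/

/-- Entry `(i, j)` of the matrices `V_k⁺` (`j ≤ k`) and `W_k⁺` (`j ≤ k + 1`): the identity pattern
together with the pattern of ones on the antidiagonal `i + j = k + 1`. -/
def entryPlus (K : Type*) [Field K] (k i j : ℕ) : K :=
  if i = j then 1 else if i + j = k + 1 then 1 else 0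

/-- Entry `(i, j)` of the matrices `V_k⁻` (`j ≤ k`) and `W_k⁻` (`j ≤ k + 1`). -/
def entryMinus (K : Type*) [Field K] (k i j : ℕ) : K :=
  if i = j then 1 else if i + j = k + 1 then -1 else 0

/-- Number of rows of `V_k⁺` and `W_k⁺`: `(k + 3) / 2` if `k` is odd, `(k + 2) / 2` if `k` is even.
The matrices `V_k⁻` and `W_k⁻` have `k + 2 - rowsPlus k` rows. -/
def rowsPlus (k : ℕ) : ℕ := (k + 3) / 2

/-- The square matrix `P_k(m)` of size `2k + 2`, with block rows
`[V_k⁺, 0]`, `[0, V_k⁻]`, `[(0 I_k), -m (0 I_k)]`. -/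
def matP {K : Type*} [Field K] (k : ℕ) (m : K) : Matrix (Fin (2 * k + 2)) (Fin (2 * k + 2)) K :=
  fun r s =>
    if (r : ℕ) < rowsPlus k then
      (if (s : ℕ) < k + 1 then entryPlus K k r s else 0)
    else if (r : ℕ) < k + 2 then
      (if (s : ℕ) < k + 1 then 0 else entryMinus K k (r - rowsPlus k) (s - (k + 1)))
    else if (s : ℕ) = (r - (k + 2)) + 1 then 1
    else if (s : ℕ) = (k + 1) + ((r - (k + 2)) + 1) then -m
    else 0

/-- The `(2k + 2) × (2k + 4)` matrix `Q_k`, with block rows `[W_k⁺, 0]`, `[0, W_k⁻]`, `[0, 0]`. -/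
def matQ (K : Type*) [Field K] (k : ℕ) : Matrix (Fin (2 * k + 2)) (Fin (2 * k + 4)) K :=
  fun r s =>
    if (r : ℕ) < rowsPlus k then
      (if (s : ℕ) < k + 2 then entryPlus K k r s else 0)
    else if (r : ℕ) < k + 2 then
      (if (s : ℕ) < k + 2 then 0 else entryMinus K k (r - rowsPlus k) (s - (k + 2)))
    else 0

/-- The quotient `(w[1] + w[k+2]) / (w[k+3] - w[2k+4])` attached to a vector `w` of
length `2k + 4`. -/
def ratio {K : Type*} [Field K] (k : ℕ) (w : ℕ → K) : K :=
  (w 1 + w (k + 2)) / (w (k + 3) - w (2 * k + 4))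

/-- One step `w ↦ P_k(m_k)⁻¹ Q_k w` of the linear system, from vectors of length `2k + 4` to
vectors of length `2k + 2`, where `m_k = ratio k w`. -/
def step {K : Type*} [Field K] (k : ℕ) (w : ℕ → K) : ℕ → K := fun j =>
  if h : 1 ≤ j ∧ j ≤ 2 * k + 2 then
    Matrix.mulVec (matP k (ratio k w))⁻¹
      (Matrix.mulVec (matQ K k) (fun i : Fin (2 * k + 4) => w ((i : ℕ) + 1)))
      ⟨j - 1, by omega⟩
  else 0

/-- The vectors `v_g(0), v_g(1), …, v_g(2g)` generated by the initial vector `v0`; the vector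
`v_g(n)` has length `4g - 2n + 2`. -/
def vec {K : Type*} [Field K] (g : ℕ) (v0 : ℕ → K) : ℕ → ℕ → K
  | 0 => v0
  | n + 1 => step (2 * g - (n + 1)) (vec g v0 n)

/-! ### The rational functions -/

/-- The field `F(c_0, …, c_g)` of rational functions over `F` in the indeterminates
`c_0, …, c_g`. -/
abbrev RatFun (F : Type*) [Field F] (g : ℕ) : Type _ :=
  FractionRing (MvPolynomial (Fin (g + 1)) F)

/-- The indeterminate `c_{min(i, 2g - i)}`, the coefficient of `x ^ (2g - i)` in `P_g(x)`
for `0 ≤ i ≤ 2g`. -/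
def coeffVar (g i : ℕ) : RatFun ℝ g :=
  algebraMap (MvPolynomial (Fin (g + 1)) ℝ) (RatFun ℝ g)
    (MvPolynomial.X ⟨min i (2 * g - i), by omega⟩)

/-- The initial vector of length `4g + 2`:
first `c_0, c_1, …, c_{g-1}, c_g, c_{g-1}, …, c_0`, then
`c_0 log(q^g), …, c_{g-1} log q, 0, -c_{g-1} log q, …, -c_0 log(q^g)`. -/
def initVec (g : ℕ) (q : ℝ) : ℕ → RatFun ℝ g := fun j =>
  if j ≤ 2 * g + 1 then coeffVar g (j - 1)
  else coeffVar g (j - (2 * g + 2)) *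
    algebraMap ℝ (RatFun ℝ g) (Real.log (q ^ ((g : ℤ) - ((j - (2 * g + 2) : ℕ) : ℤ))))

/-- The rational functions `m_k(c; log q)` for `0 ≤ k ≤ 2g`: `m_{2g} = 1 / (g log q)`, and
`m_{2g-n}` is the quotient attached to `v_g(n-1)` for `1 ≤ n ≤ 2g`. -/
def mCoeff (g : ℕ) (q : ℝ) (k : ℕ) : RatFun ℝ g :=
  if k = 2 * g then algebraMap ℝ (RatFun ℝ g) (1 / ((g : ℝ) * Real.log q))
  else ratio k (vec g (initVec g q) (2 * g - k - 1))

/-- The ratio products `R_n` for `0 ≤ n ≤ 2g`, formed with `m_k(c; log q)`. For `n = 2J + 1` it is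
`∏_{j=0}^{J} m_{2g-(2j+1)} / m_{2g-2j}`, for `n = 2J + 2` it is
`∏_{j=0}^{J} m_{2g-(2j+2)} / m_{2g-(2j+1)}`, and for `n = 0` it is `1` (the empty product). -/
def ratioProd (g : ℕ) (q : ℝ) (n : ℕ) : RatFun ℝ g :=
  if Even n then
    ∏ j ∈ Finset.range (n / 2), mCoeff g q (2 * g - (2 * j + 2)) / mCoeff g q (2 * g - (2 * j + 1))
  else
    ∏ j ∈ Finset.range (n / 2 + 1), mCoeff g q (2 * g - (2 * j + 1)) / mCoeff g q (2 * g - 2 * j)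

theorem map_rat_injective (g : ℕ) : Function.Injective
    (MvPolynomial.map (algebraMap ℚ ℝ) :
      MvPolynomial (Fin (g + 1)) ℚ →+* MvPolynomial (Fin (g + 1)) ℝ) :=
  MvPolynomial.map_injective _ (algebraMap ℚ ℝ).injective

/-- The inclusion `ℚ(c_0, …, c_g) → ℝ(c_0, …, c_g)`. -/
def ratToReal (g : ℕ) : RatFun ℚ g →+* RatFun ℝ g :=
  IsFractionRing.map (map_rat_injective g)

/-- `HasValueAt r c y`: the rational function `r` is defined (finite) at the real point `c`,
that is, it can be written as a fraction whose denominator does not vanish at `c`,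
and its value there is `y`. -/
def HasValueAt {g : ℕ} (r : RatFun ℚ g) (c : Fin (g + 1) → ℝ) (y : ℝ) : Prop :=
  ∃ p s : MvPolynomial (Fin (g + 1)) ℚ,
    MvPolynomial.aeval c s ≠ 0 ∧
    r = algebraMap _ (RatFun ℚ g) p / algebraMap _ (RatFun ℚ g) s ∧
    y = MvPolynomial.aeval c p / MvPolynomial.aeval c s

/-- The rational function `r` has a (finite) positive value at the real point `c`. -/
def PosAt {g : ℕ} (r : RatFun ℚ g) (c : Fin (g + 1) → ℝ) : Prop :=
  ∃ y : ℝ, HasValueAt r c y ∧ 0 < y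

/-! ### The polynomial -/

/-- `P_g(x) = ∑_{k=0}^{g-1} c_k (x^{2g-k} + x^k) + c_g x^g`. -/
def selfRecPoly (g : ℕ) (c : Fin (g + 1) → ℝ) : ℝ[X] :=
  (∑ k : Fin g, C (c k.castSucc) * (X ^ (2 * g - (k : ℕ)) + X ^ (k : ℕ))) + C (c (Fin.last g)) * X ^ g

/-- All complex zeros of `P` lie on the unit circle and are simple. -/
def ZerosOnCircleSimple (P : ℝ[X]) : Prop :=
  ∀ z : ℂ, (P.map (algebraMap ℝ ℂ)).IsRoot z →
    ‖z‖ = 1 ∧ (P.map (algebraMap ℝ ℂ)).rootMultiplicity z = 1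

end

end SelfReciprocal

namespace SelfReciprocal

/-! The linear system is the Schur–Cohn algorithm in disguise. Write `P` for the self-reciprocal
polynomial and `p*` for the reversal of `p` with respect to its formal degree.

All zeros of `P` are simple and on the circle exactly when `G = 2P - xP'/g`, the reversed derivative
up to a constant, has no zero in the closed disc (`zerosOnCircleSimple_iff`). For such a zero-free
`p` one has `|p*| ≤ |p|` on the disc, so for `r > 0` the mixture `((1 + r)p + (1 - r)p*)/2` is again
zero-free; since `r⁻¹` undoes `r`, this is an equivalence. With `r = (a_0 + a_N)/(a_0 - a_N)` the
top coefficient disappears, and `r > 0` says `|a_N| < |a_0|`, which zero-freeness forces. Descending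
from `G`, zero-freeness becomes positivity of the `2g - 1` ratios `schurRatio`
(`nonvanishingOnDisc_schurVec_iff_add`).

On the other side, the vectors `v(n + 1)` of the system have the form `(a, a/m)`, where `a` is the
`n`-th Schur–Cohn vector and `m = m_{2g-1-n}` (`vec_succ_eq_pairVec`). Hence the quotient of
successive `m`'s is a Schur–Cohn ratio: `log q` enters only through the common scale of the `m`'s
and cancels. Moreover `R_0 = R_1 = 1`, and `R_{n+2}/R_n` is the `n`-th ratio, so positivity of all
`R_n` is positivity of all ratios. Passing between rational functions and their values at a point is
done by induction along the recursion (`forall_schurRatio_pos_iff`). -/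

/-- The polynomial `∑_{i ≤ N} a_i x ^ i`. -/
noncomputable def polyOf (N : ℕ) (a : ℕ → ℝ) : ℝ[X] :=
  ∑ i ∈ Finset.range (N + 1), C (a i) * X ^ i

/-- The polynomial has no zeros in the closed unit disc. -/
def NonvanishingOnDisc (p : ℝ[X]) : Prop := ∀ z : ℂ, ‖z‖ ≤ 1 → aeval z p ≠ 0

theorem coeff_polyOf (N : ℕ) (a : ℕ → ℝ) (i : ℕ) :
    (polyOf N a).coeff i = if i ≤ N then a i else 0 := by
  simp only [polyOf, finsetSum_coeff, coeff_C_mul, coeff_X_pow, mul_ite, mul_one, mul_zero,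
    Finset.sum_ite_eq, Finset.mem_range, Nat.lt_succ_iff]

theorem natDegree_polyOf_le (N : ℕ) (a : ℕ → ℝ) : (polyOf N a).natDegree ≤ N :=
  natDegree_le_iff_coeff_eq_zero.2 fun i hi => by rw [coeff_polyOf, if_neg (by omega)]

theorem aeval_polyOf (N : ℕ) (a : ℕ → ℝ) (z : ℂ) :
    aeval z (polyOf N a) = ∑ i ∈ Finset.range (N + 1), (a i : ℂ) * z ^ i := by
  simp [polyOf]

theorem aeval_zero_polyOf (N : ℕ) (a : ℕ → ℝ) : aeval (0 : ℂ) (polyOf N a) = a 0 := by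
  rw [aeval_polyOf, Finset.sum_range_succ']
  simp

theorem polyOf_congr {N : ℕ} {a b : ℕ → ℝ} (h : ∀ i ≤ N, a i = b i) : polyOf N a = polyOf N b :=
  Finset.sum_congr rfl fun i hi => by rw [h i (by simpa [Nat.lt_succ_iff] using hi)]

theorem polyOf_succ_eq {N : ℕ} {a : ℕ → ℝ} (h : a (N + 1) = 0) :
    polyOf (N + 1) a = polyOf N a := by
  rw [polyOf, Finset.sum_range_succ, h]
  simp [polyOf]

theorem aeval_polyOf_reverse (N : ℕ) (a : ℕ → ℝ) {z : ℂ} (hz : z ≠ 0) :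
    aeval z (polyOf N fun i => a (N - i)) = z ^ N * aeval z⁻¹ (polyOf N a) := by
  rw [aeval_polyOf, aeval_polyOf, ← Finset.sum_range_reflect, Finset.mul_sum]
  refine Finset.sum_congr rfl fun i hi => ?_
  have hi : i ≤ N := by simpa [Nat.lt_succ_iff] using hi
  rw [show N + 1 - 1 - i = N - i by omega, show N - (N - i) = i by omega]
  have : z ^ N = z ^ (N - i) * z ^ i := by rw [← pow_add]; congr 1; omega
  rw [this, inv_pow]
  field_simp

/-! ### Comparison of a zero-free polynomial with its reversal on the disc -/

/-- The Blaschke factor estimate: `|z - w|² - |1 - z̄w|² = (1 - |z|²)(|w|² - 1)`. -/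
theorem norm_mul_norm_conj_inv_sub_le {z w : ℂ} (hz : z ≠ 0) (hz1 : ‖z‖ ≤ 1) (hw : 1 ≤ ‖w‖) :
    ‖z‖ * ‖starRingEnd ℂ z⁻¹ - w‖ ≤ ‖z - w‖ := by
  have e : ‖z‖ * ‖starRingEnd ℂ z⁻¹ - w‖ = ‖1 - starRingEnd ℂ z * w‖ := by
    rw [← Complex.norm_conj z, ← norm_mul]
    congr 1
    have : starRingEnd ℂ z ≠ 0 := by simpa using hz
    rw [map_inv₀]
    field_simp
  rw [e]
  refine le_of_sq_le_sq ?_ (norm_nonneg _)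
  have hz2 : ‖z‖ ^ 2 ≤ 1 := pow_le_one₀ (norm_nonneg _) hz1
  have hw2 : 1 ≤ ‖w‖ ^ 2 := one_le_pow₀ hw
  rw [Complex.sq_norm, Complex.normSq_apply] at hz2 hw2
  rw [Complex.sq_norm, Complex.sq_norm, Complex.normSq_apply, Complex.normSq_apply]
  simp only [Complex.sub_re, Complex.sub_im, Complex.mul_re, Complex.mul_im, Complex.conj_re,
    Complex.conj_im, Complex.one_re, Complex.one_im]
  nlinarith [mul_nonneg (sub_nonneg.2 hz2) (sub_nonneg.2 hw2)]

theorem pow_mul_norm_prod_conj_inv_le {z : ℂ} (hz : z ≠ 0) (hz1 : ‖z‖ ≤ 1) (s : Multiset ℂ)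
    (hs : ∀ w ∈ s, 1 ≤ ‖w‖) :
    ‖z‖ ^ s.card * ‖(s.map (starRingEnd ℂ z⁻¹ - ·)).prod‖ ≤ ‖(s.map (z - ·)).prod‖ := by
  induction s using Multiset.induction_on with
  | empty => simp
  | cons w s ih =>
    simp only [Multiset.map_cons, Multiset.prod_cons, norm_mul, Multiset.card_cons, pow_succ]
    have h1 := norm_mul_norm_conj_inv_sub_le hz hz1 (hs w (Multiset.mem_cons_self _ _))
    have h2 := ih fun w hw => hs w (Multiset.mem_cons_of_mem hw)
    calc _ = (‖z‖ * ‖starRingEnd ℂ z⁻¹ - w‖) *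
          (‖z‖ ^ s.card * ‖(s.map (starRingEnd ℂ z⁻¹ - ·)).prod‖) := by ring
      _ ≤ _ := mul_le_mul h1 h2 (by positivity) (norm_nonneg _)

theorem NonvanishingOnDisc.ne_zero {p : ℝ[X]} (hp : NonvanishingOnDisc p) : p ≠ 0 := by
  rintro rfl
  exact hp 0 (by simp) (by simp)

theorem NonvanishingOnDisc.one_lt_norm {p : ℝ[X]} (hp : NonvanishingOnDisc p) {w : ℂ}
    (hw : w ∈ p.aroots ℂ) : 1 < ‖w‖ := by
  by_contra! h
  exact hp w h (mem_aroots.1 hw).2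

theorem aeval_eq_prod_aroots (p : ℝ[X]) (z : ℂ) :
    aeval z p = (p.leadingCoeff : ℂ) * ((p.aroots ℂ).map (z - ·)).prod :=
  Splits.aeval_eq_prod_aroots (IsAlgClosed.splits _) z

theorem card_aroots (p : ℝ[X]) : (p.aroots ℂ).card = p.natDegree := by
  rw [aroots, ← (IsAlgClosed.splits (p.map (algebraMap ℝ ℂ))).natDegree_eq_card_roots,
    natDegree_map]

/-- Real coefficients allow `z⁻¹` to be replaced by its conjugate, after which the Blaschke estimate
applies to each linear factor. A formal degree above the true one only shrinks the left side. -/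
theorem NonvanishingOnDisc.pow_mul_norm_aeval_inv_le {p : ℝ[X]} (hp : NonvanishingOnDisc p)
    {N : ℕ} (hN : p.natDegree ≤ N) {z : ℂ} (hz : z ≠ 0) (hz1 : ‖z‖ ≤ 1) :
    ‖z‖ ^ N * ‖aeval z⁻¹ p‖ ≤ ‖aeval z p‖ := by
  have e : ‖aeval z⁻¹ p‖ = ‖aeval (starRingEnd ℂ z⁻¹) p‖ := by
    rw [aeval_conj, Complex.norm_conj]
  have h := pow_mul_norm_prod_conj_inv_le hz hz1 (p.aroots ℂ)
    fun w hw => (hp.one_lt_norm hw).le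
  rw [card_aroots] at h
  rw [e, aeval_eq_prod_aroots, aeval_eq_prod_aroots, norm_mul, norm_mul]
  have h3 : ‖z‖ ^ N ≤ ‖z‖ ^ p.natDegree := pow_le_pow_of_le_one (norm_nonneg _) hz1 hN
  calc _ = ‖(p.leadingCoeff : ℂ)‖ * (‖z‖ ^ N *
        ‖((p.aroots ℂ).map (starRingEnd ℂ z⁻¹ - ·)).prod‖) := by ring
    _ ≤ _ := by
      refine mul_le_mul_of_nonneg_left (le_trans ?_ h) (norm_nonneg _)
      exact mul_le_mul_of_nonneg_right h3 (norm_nonneg _)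

theorem one_le_norm_prod (s : Multiset ℂ) (hs : ∀ w ∈ s, 1 < ‖w‖) :
    1 ≤ ‖(s.map ((0 : ℂ) - ·)).prod‖ := by
  induction s using Multiset.induction_on with
  | empty => simp
  | cons w s ih =>
    simp only [Multiset.map_cons, Multiset.prod_cons, norm_mul, zero_sub, norm_neg]
    have h2 := ih fun w hw => hs w (Multiset.mem_cons_of_mem hw)
    simp only [zero_sub] at h2
    exact one_le_mul_of_one_le_of_one_le (hs w (Multiset.mem_cons_self _ _)).le h2

theorem one_lt_norm_prod (s : Multiset ℂ) (hs : ∀ w ∈ s, 1 < ‖w‖) (h0 : s.card ≠ 0) :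
    1 < ‖(s.map ((0 : ℂ) - ·)).prod‖ := by
  obtain ⟨w, hw⟩ := Multiset.card_pos_iff_exists_mem.1 (Nat.pos_of_ne_zero h0)
  obtain ⟨t, rfl⟩ := Multiset.exists_cons_of_mem hw
  simp only [Multiset.map_cons, Multiset.prod_cons, norm_mul, zero_sub, norm_neg]
  have h2 := one_le_norm_prod t fun w hw => hs w (Multiset.mem_cons_of_mem hw)
  simp only [zero_sub] at h2
  nlinarith [hs w hw]

/-- In true degree `N`, `|a_0|` is `|a_N|` times the product of the moduli of the zeros, all greater
than `1`; in lower degree `a_N = 0`. -/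
theorem abs_coeff_lt_of_nonvanishingOnDisc {N : ℕ} (hN : N ≠ 0) {a : ℕ → ℝ}
    (h : NonvanishingOnDisc (polyOf N a)) : |a N| < |a 0| := by
  have h0 : a 0 ≠ 0 := fun h0 => h 0 (by simp) (by rw [aeval_zero_polyOf, h0]; simp)
  rcases (natDegree_polyOf_le N a).lt_or_eq with hd | hd
  · have := coeff_eq_zero_of_natDegree_lt hd
    rw [coeff_polyOf, if_pos le_rfl] at this
    rw [this]
    simpa using h0
  · have hl : (polyOf N a).leadingCoeff = a N := by
      rw [leadingCoeff, hd, coeff_polyOf, if_pos le_rfl]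
    have h1 := one_lt_norm_prod _ (fun w hw => h.one_lt_norm hw) (by rw [card_aroots, hd]; exact hN)
    have h2 := congrArg norm (aeval_eq_prod_aroots (polyOf N a) 0)
    have h3 : a N ≠ 0 := by rw [← hl]; exact leadingCoeff_ne_zero.2 h.ne_zero
    rw [aeval_zero_polyOf, hl, norm_mul, Complex.norm_real, Complex.norm_real, Real.norm_eq_abs,
      Real.norm_eq_abs] at h2
    rw [h2]
    exact lt_mul_of_one_lt_right (abs_pos.2 h3) h1

theorem NonvanishingOnDisc.norm_aeval_reverse_le {N : ℕ} {a : ℕ → ℝ}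
    (h : NonvanishingOnDisc (polyOf N a)) {z : ℂ} (hz1 : ‖z‖ ≤ 1) :
    ‖aeval z (polyOf N fun i => a (N - i))‖ ≤ ‖aeval z (polyOf N a)‖ := by
  by_cases hz : z = 0
  · subst hz
    rw [aeval_zero_polyOf, aeval_zero_polyOf, Complex.norm_real, Complex.norm_real, Nat.sub_zero]
    rcases eq_or_ne N 0 with rfl | hN
    · rfl
    · exact (abs_coeff_lt_of_nonvanishingOnDisc hN h).le
  · rw [aeval_polyOf_reverse _ _ hz, norm_mul, norm_pow]
    exact h.pow_mul_norm_aeval_inv_le (natDegree_polyOf_le N a) hz hz1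

/-! ### Mixing a polynomial with its reversal -/

/-- The combination `((1 + r) a_i + (1 - r) a_{N - i}) / 2` of a sequence with its reversal. -/
def mixReverse {K : Type*} [Field K] (N : ℕ) (r : K) (a : ℕ → K) : ℕ → K := fun i =>
  ((1 + r) * a i + (1 - r) * a (N - i)) / 2

theorem aeval_mixReverse (N : ℕ) (r : ℝ) (a : ℕ → ℝ) (z : ℂ) :
    aeval z (polyOf N (mixReverse N r a)) = ((1 + r) * aeval z (polyOf N a) +
      (1 - r) * aeval z (polyOf N fun i => a (N - i))) / 2 := by
  simp only [aeval_polyOf, mixReverse, Finset.mul_sum, ← Finset.sum_add_distrib, Finset.sum_div]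
  refine Finset.sum_congr rfl fun i _ => ?_
  push_cast
  ring

/-- At a zero, `(1 + r)|p| = |1 - r||p*| ≤ |1 - r||p|`, while `|1 - r| < 1 + r`. -/
theorem NonvanishingOnDisc.mixReverse {N : ℕ} {r : ℝ} (hr : 0 < r) {a : ℕ → ℝ}
    (h : NonvanishingOnDisc (polyOf N a)) :
    NonvanishingOnDisc (polyOf N (mixReverse N r a)) := by
  intro z hz h0
  rw [aeval_mixReverse, div_eq_zero_iff, or_iff_left (by norm_num)] at h0
  have h1 := h.norm_aeval_reverse_le hz
  have h2 := norm_pos_iff.2 (h z hz)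
  have h3 := congrArg norm (eq_neg_of_add_eq_zero_left h0)
  rw [norm_neg, norm_mul, norm_mul] at h3
  have h4 : ‖(1 + r : ℂ)‖ = 1 + r := by
    rw [← Complex.ofReal_one, ← Complex.ofReal_add, Complex.norm_real, Real.norm_eq_abs,
      abs_of_pos (by linarith)]
  have h5 : ‖(1 - r : ℂ)‖ < 1 + r := by
    rw [← Complex.ofReal_one, ← Complex.ofReal_sub, Complex.norm_real, Real.norm_eq_abs, abs_lt]
    constructor <;> linarith
  rw [h4] at h3
  nlinarith [norm_nonneg (1 - r : ℂ)]

/-- Mixing fixes the palindromic part of `a` and multiplies the antipalindromic part by `r`. -/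
theorem mixReverse_inv_mixReverse {N : ℕ} {r : ℝ} (hr : r ≠ 0) (a : ℕ → ℝ) {i : ℕ} (hi : i ≤ N) :
    mixReverse N r⁻¹ (mixReverse N r a) i = a i := by
  simp only [mixReverse, show N - (N - i) = i by omega]
  field_simp
  ring

theorem nonvanishingOnDisc_mixReverse_iff {N : ℕ} {r : ℝ} (hr : 0 < r) {a : ℕ → ℝ} :
    NonvanishingOnDisc (polyOf N (mixReverse N r a)) ↔ NonvanishingOnDisc (polyOf N a) := by
  refine ⟨fun h => ?_, fun h => h.mixReverse hr⟩
  have := h.mixReverse (inv_pos.2 hr)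
  rwa [polyOf_congr fun i hi => mixReverse_inv_mixReverse hr.ne' a hi] at this

/-! ### Self-reciprocal polynomials -/

theorem X_mul_derivative_polyOf (N : ℕ) (a : ℕ → ℝ) :
    X * derivative (polyOf N a) = polyOf N fun i => i * a i := by
  rw [polyOf, derivative_sum, Finset.mul_sum]
  refine Finset.sum_congr rfl fun i _ => ?_
  rw [derivative_C_mul_X_pow]
  cases i with
  | zero => simp
  | succ i =>
    simp only [add_tsub_cancel_right, pow_succ, map_mul]
    ring

/-- The expression is `1 / (1 - z/w)`, and `t ↦ 1/(1 - t)` maps the closed disc minus `1` into the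
half-plane `Re ≥ 1/2`. -/
theorem half_le_re_one_sub {z w : ℂ} (hz : ‖z‖ ≤ 1) (hw : ‖w‖ = 1) (h : z ≠ w) :
    1 / 2 ≤ (1 - z * (1 / (z - w))).re := by
  have hzw : w - z ≠ 0 := sub_ne_zero.2 h.symm
  have hzw' : z - w ≠ 0 := sub_ne_zero.2 h
  have e : 1 - z * (1 / (z - w)) = w / (w - z) := by
    field_simp
    ring
  rw [e, Complex.div_re, ← add_div, div_le_div_iff₀ (by norm_num) (Complex.normSq_pos.2 hzw)]
  have hz2 : ‖z‖ ^ 2 ≤ 1 := pow_le_one₀ (norm_nonneg _) hz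
  have hw2 : ‖w‖ ^ 2 = 1 := by rw [hw]; norm_num
  rw [Complex.sq_norm, Complex.normSq_apply] at hz2 hw2
  rw [Complex.normSq_apply]
  simp only [Complex.sub_re, Complex.sub_im]
  nlinarith

theorem zerosOnCircleSimple_iff {g : ℕ} (hg : 0 < g) {a : ℕ → ℝ} (ha0 : a 0 ≠ 0)
    (ha : ∀ i ≤ 2 * g, a (2 * g - i) = a i) :
    ZerosOnCircleSimple (polyOf (2 * g) a) ↔
      NonvanishingOnDisc (polyOf (2 * g - 1) fun i => ((2 * g : ℕ) - (i : ℝ)) / g * a i) := by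
  set P := polyOf (2 * g) a with hP
  set G : ℕ → ℝ := fun i => ((2 * g : ℕ) - (i : ℝ)) / g * a i with hG
  have hg' : (g : ℂ) ≠ 0 := by exact_mod_cast hg.ne'
  have hg'' : (g : ℝ) ≠ 0 := by exact_mod_cast hg.ne'
  -- The factor `2g - i` kills the coefficient at `i = 2g`, so `G` has formal degree `2g - 1`. It is
  -- also reversed in degree `2g` below, and this discrepancy of one is what the converse exploits.
  have hGP : polyOf (2 * g - 1) G = polyOf (2 * g) G := by
    conv_rhs => rw [show 2 * g = 2 * g - 1 + 1 by omega]
    rw [polyOf_succ_eq]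
    simp [hG, show 2 * g - 1 + 1 = 2 * g by omega]
  have hGe : ∀ z : ℂ, aeval z (polyOf (2 * g) G) =
      2 * aeval z P - z * aeval z (derivative P) / g := by
    intro z
    have h := congrArg (aeval z) (X_mul_derivative_polyOf (2 * g) a)
    rw [map_mul, aeval_X, ← hP] at h
    rw [h, hP]
    simp only [aeval_polyOf, Finset.mul_sum, Finset.sum_div, ← Finset.sum_sub_distrib]
    refine Finset.sum_congr rfl fun i _ => ?_
    simp only [hG]
    push_cast
    field_simp
  have hGr : ∀ z : ℂ, aeval z (polyOf (2 * g) fun i => G (2 * g - i)) =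
      z * aeval z (derivative P) / g := by
    intro z
    have h := congrArg (aeval z) (X_mul_derivative_polyOf (2 * g) a)
    rw [map_mul, aeval_X, ← hP] at h
    rw [h]
    simp only [aeval_polyOf, Finset.sum_div]
    refine Finset.sum_congr rfl fun i hi => ?_
    have hi : i ≤ 2 * g := by simpa [Nat.lt_succ_iff] using hi
    simp only [hG, ha i hi]
    rw [Nat.cast_sub hi]
    push_cast
    field_simp
    ring
  have hPr : ∀ z : ℂ, z ≠ 0 → aeval z P = z ^ (2 * g) * aeval z⁻¹ P := by
    intro z hz
    rw [hP, ← aeval_polyOf_reverse _ _ hz, polyOf_congr ha]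
  have hP0 : aeval (0 : ℂ) P ≠ 0 := by
    rw [hP, aeval_zero_polyOf]
    exact_mod_cast ha0
  have hPne : P ≠ 0 := fun h => hP0 (by rw [h, map_zero])
  have hPne' : P.map (algebraMap ℝ ℂ) ≠ 0 :=
    (Polynomial.map_ne_zero_iff (algebraMap ℝ ℂ).injective).2 hPne
  have hroot : ∀ z : ℂ, (P.map (algebraMap ℝ ℂ)).IsRoot z ↔ aeval z P = 0 := fun z => by
    rw [IsRoot, eval_map_algebraMap]
  have hmult : ∀ z : ℂ, aeval z P = 0 →
      ((P.map (algebraMap ℝ ℂ)).rootMultiplicity z = 1 ↔ aeval z (derivative P) ≠ 0) := by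
    intro z hz
    have h1 := one_lt_rootMultiplicity_iff_isRoot hPne' (t := z)
    have h2 := (rootMultiplicity_pos hPne').2 ((hroot z).2 hz)
    rw [hroot, derivative_map, IsRoot, eval_map_algebraMap] at h1
    constructor
    · intro h h'
      have := h1.2 ⟨hz, h'⟩
      omega
    · intro h
      have := mt h1.1 fun h' => h h'.2
      omega
  rw [hGP]
  constructor
  · intro h z hz hGz
    have hzr := hGe z
    rw [hGz] at hzr
    by_cases hPz : aeval z P = 0
    · obtain ⟨hz1, hz2⟩ := h z ((hroot z).2 hPz)
      rw [hmult z hPz] at hz2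
      have hz0 : z ≠ 0 := by
        rintro rfl
        simp at hz1
      rw [hPz, mul_zero, zero_sub, eq_comm, neg_eq_zero, div_eq_zero_iff,
        or_iff_left hg', mul_eq_zero] at hzr
      exact hzr.elim hz0 hz2
    · have hsplit := IsAlgClosed.splits (P.map (algebraMap ℝ ℂ))
      have hd := hsplit.eval_derivative_div_eval_of_ne_zero (x := z)
        (by rwa [eval_map_algebraMap])
      rw [derivative_map, eval_map_algebraMap, eval_map_algebraMap] at hd
      have hdeg : P.natDegree = 2 * g := by
        refine natDegree_eq_of_le_of_coeff_ne_zero (natDegree_polyOf_le _ _) ?_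
        rw [coeff_polyOf, if_pos le_rfl, ← ha _ le_rfl, Nat.sub_self]
        exact ha0
      have hcard := card_aroots P
      rw [hdeg, aroots] at hcard
      set s := (P.map (algebraMap ℝ ℂ)).roots with hs
      -- By the logarithmic derivative the sum is `2g - zP'/P = gG/P`, which vanishes at `z`; but
      -- its `2g` terms each have real part at least `1/2`.
      have hsum : (s.map fun w => 1 - z * (1 / (z - w))).sum = 0 := by
        rw [Multiset.sum_map_sub, Multiset.sum_map_mul_left, ← hd, Multiset.map_const',
          Multiset.sum_replicate, hcard]
        simp only [nsmul_eq_mul, mul_one]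
        push_cast
        field_simp
        field_simp at hzr
        linear_combination -hzr
      have hre := congrArg Complex.re hsum
      have hadd := map_multiset_sum Complex.reAddGroupHom (s.map fun w => 1 - z * (1 / (z - w)))
      rw [Complex.coe_reAddGroupHom, hsum, Multiset.map_map] at hadd
      have hle := Multiset.card_nsmul_le_sum (a := (1 / 2 : ℝ))
        (s := s.map (Complex.re ∘ fun w => 1 - z * (1 / (z - w)))) (by
          intro x hx
          obtain ⟨w, hw, rfl⟩ := Multiset.mem_map.1 hx
          have hw' := isRoot_of_mem_roots hw
          refine half_le_re_one_sub hz (h w hw').1 ?_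
          rintro rfl
          exact hPz ((hroot _).1 hw'))
      rw [← hadd, Multiset.card_map, hcard, Complex.zero_re, nsmul_eq_mul] at hle
      push_cast at hle
      have : (0 : ℝ) < g := by exact_mod_cast hg
      linarith
  · intro h
    have hin : ∀ z : ℂ, ‖z‖ < 1 → aeval z P ≠ 0 := by
      intro z hz hPz
      by_cases hz0 : z = 0
      · rw [hz0] at hPz
        exact hP0 hPz
      -- At a zero of `P` one has `G* = -G` for the reversal in degree `2g`, so `|z|^{2g}|G(z⁻¹)| =
      -- |G(z)|`. The bound in degree `2g - 1` then gives `|G(z)| ≤ |z||G(z)|`, impossible for `|z|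
      -- < 1`.
      have h1 : ‖z‖ ^ (2 * g - 1) * ‖aeval z⁻¹ (polyOf (2 * g) G)‖ ≤ _ :=
        h.pow_mul_norm_aeval_inv_le (by rw [← hGP]; exact natDegree_polyOf_le _ _) hz0 hz.le
      have h2 := congrArg norm (aeval_polyOf_reverse (2 * g) G hz0)
      rw [norm_mul, norm_pow, show 2 * g = 2 * g - 1 + 1 by omega, pow_succ,
        show 2 * g - 1 + 1 = 2 * g by omega, hGr] at h2
      have h3 := hGe z
      have h4 := norm_pos_iff.2 (h z hz.le)
      rw [hPz, mul_zero, zero_sub] at h3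
      rw [h3, norm_neg] at h1 h4
      nlinarith [norm_nonneg z]
    intro z hz
    rw [hroot] at hz
    have hz0 : z ≠ 0 := by
      rintro rfl
      exact hP0 hz
    have hz1 : ‖z‖ = 1 := by
      refine le_antisymm ?_ (not_lt.1 fun hlt => hin z hlt hz)
      by_contra! hlt
      refine hin z⁻¹ (by rw [norm_inv]; exact inv_lt_one_of_one_lt₀ hlt) ?_
      have := hPr z hz0
      rw [hz, eq_comm, mul_eq_zero] at this
      exact this.resolve_left (pow_ne_zero _ hz0)
    refine ⟨hz1, (hmult z hz).2 fun hd => h z hz1.le ?_⟩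
    rw [hGe, hz, hd]
    simp

/-- The coefficients `c_{min(i, 2g - i)}` of `P_g`. -/
def palCoeff {K : Type*} {g : ℕ} (c : Fin (g + 1) → K) (i : ℕ) : K :=
  c ⟨min i (2 * g - i), by omega⟩

theorem palCoeff_sub {K : Type*} {g : ℕ} (c : Fin (g + 1) → K) {i : ℕ} (hi : i ≤ 2 * g) :
    palCoeff c (2 * g - i) = palCoeff c i := by
  simp only [palCoeff]
  congr 2
  omega

theorem selfRecPoly_eq_polyOf (g : ℕ) (c : Fin (g + 1) → ℝ) :
    selfRecPoly g c = polyOf (2 * g) (palCoeff c) := by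
  rw [polyOf, show 2 * g + 1 = (g + 1) + g by ring, Finset.sum_range_add, Finset.sum_range_succ,
    ← Finset.sum_range_reflect (fun i => C (palCoeff c (g + 1 + i)) * X ^ (g + 1 + i)),
    add_right_comm, ← Finset.sum_add_distrib, Finset.sum_range, selfRecPoly]
  congr 1
  · refine Finset.sum_congr rfl fun k _ => ?_
    have hk := k.2
    have e : g + 1 + (g - 1 - (k : ℕ)) = 2 * g - k := by omega
    rw [e, palCoeff_sub c (by omega)]
    have : palCoeff c (k : ℕ) = c k.castSucc := by
      simp only [palCoeff]
      congr 1
      ext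
      simp only [Fin.val_castSucc]
      omega
    rw [this]
    ring
  · congr 2
    simp only [palCoeff]
    congr 1
    ext
    simp only [Fin.val_last]
    omega

/-! ### The Schur–Cohn recursion -/

/-- The ratio `(a_0 + a_N) / (a_0 - a_N)`. -/
def endRatio {K : Type*} [Field K] (N : ℕ) (a : ℕ → K) : K := (a 0 + a N) / (a 0 - a N)

/-- The Schur–Cohn sequence started at the reversed derivative of `P_g`: the `n`-th member has
formal degree `2g - 1 - n`. -/
def schurVec {K : Type*} [Field K] {g : ℕ} (c : Fin (g + 1) → K) : ℕ → ℕ → K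
  | 0 => fun i => (((2 * g : ℕ) : K) - (i : K)) / g * palCoeff c i
  | n + 1 => mixReverse (2 * g - 1 - n) (endRatio (2 * g - 1 - n) (schurVec c n)) (schurVec c n)

/-- The Schur–Cohn ratios. -/
def schurRatio {K : Type*} [Field K] {g : ℕ} (c : Fin (g + 1) → K) (n : ℕ) : K :=
  endRatio (2 * g - 1 - n) (schurVec c n)

theorem schurVec_succ {K : Type*} [Field K] {g : ℕ} (c : Fin (g + 1) → K) (n : ℕ) :
    schurVec c (n + 1) = mixReverse (2 * g - 1 - n) (schurRatio c n) (schurVec c n) := rfl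

theorem mixReverse_endRatio_last {K : Type*} [Field K] [NeZero (2 : K)] {N : ℕ} {a : ℕ → K}
    (h : a 0 - a N ≠ 0) : mixReverse N (endRatio N a) a N = 0 := by
  have h2 : (2 : K) ≠ 0 := NeZero.ne _
  simp only [mixReverse, endRatio, Nat.sub_self]
  field_simp
  ring

theorem mixReverse_endRatio_zero {K : Type*} [Field K] [NeZero (2 : K)] {N : ℕ} {a : ℕ → K}
    (h : a 0 - a N ≠ 0) : mixReverse N (endRatio N a) a 0 = a 0 + a N := by
  have h2 : (2 : K) ≠ 0 := NeZero.ne _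
  simp only [mixReverse, endRatio, Nat.sub_zero]
  field_simp
  ring

/-- The ratio has the sign of `a_0² - a_N²`; if `a_0 = a_N`, the convention `x / 0 = 0` makes both
sides false. -/
theorem endRatio_pos_iff {N : ℕ} {a : ℕ → ℝ} : 0 < endRatio N a ↔ |a N| < |a 0| := by
  rw [endRatio, ← sq_lt_sq, div_pos_iff]
  constructor
  · rintro (⟨h1, h2⟩ | ⟨h1, h2⟩)
    · nlinarith [mul_pos h1 h2]
    · nlinarith [mul_pos_of_neg_of_neg h1 h2]
  · intro h
    rcases lt_trichotomy (a 0 - a N) 0 with h1 | h1 | h1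
    · exact Or.inr ⟨by nlinarith, h1⟩
    · rw [sub_eq_zero.1 h1] at h
      exact absurd h (lt_irrefl _)
    · exact Or.inl ⟨by nlinarith, h1⟩

theorem sub_ne_zero_of_endRatio_pos {N : ℕ} {a : ℕ → ℝ} (h : 0 < endRatio N a) :
    a 0 - a N ≠ 0 := by
  intro h0
  rw [endRatio, h0, div_zero] at h
  exact h.false

/-- One Schur–Cohn step: the ratio is chosen so that mixing removes the top coefficient, and mixing
with a positive ratio preserves and reflects zero-freeness. -/
theorem nonvanishingOnDisc_polyOf_succ_iff {N : ℕ} {a : ℕ → ℝ} :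
    NonvanishingOnDisc (polyOf (N + 1) a) ↔ 0 < endRatio (N + 1) a ∧
      NonvanishingOnDisc (polyOf N (mixReverse (N + 1) (endRatio (N + 1) a) a)) := by
  constructor
  · intro h
    have hr := endRatio_pos_iff.2 (abs_coeff_lt_of_nonvanishingOnDisc N.succ_ne_zero h)
    refine ⟨hr, ?_⟩
    rw [← polyOf_succ_eq (mixReverse_endRatio_last (sub_ne_zero_of_endRatio_pos hr))]
    exact h.mixReverse hr
  · rintro ⟨hr, h⟩
    rw [← polyOf_succ_eq (mixReverse_endRatio_last (sub_ne_zero_of_endRatio_pos hr))] at h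
    exact (nonvanishingOnDisc_mixReverse_iff hr).1 h

theorem nonvanishingOnDisc_polyOf_zero {a : ℕ → ℝ} (h : a 0 ≠ 0) :
    NonvanishingOnDisc (polyOf 0 a) := by
  intro z _
  rw [aeval_polyOf]
  simpa using h

/-- The new constant coefficient is `a_0 + a_N`, the numerator of the positive ratio. -/
theorem schurVec_succ_zero_ne_zero {g : ℕ} {c : Fin (g + 1) → ℝ} {n : ℕ}
    (h : 0 < schurRatio c n) : schurVec c (n + 1) 0 ≠ 0 := by
  have h1 := sub_ne_zero_of_endRatio_pos h
  rw [schurVec_succ, schurRatio, mixReverse_endRatio_zero h1]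
  intro h0
  rw [schurRatio, endRatio, h0, zero_div] at h
  exact h.false

theorem nonvanishingOnDisc_schurVec_iff_add {g : ℕ} (c : Fin (g + 1) → ℝ) (j n : ℕ)
    (hjn : n + j = 2 * g - 1) (h0 : schurVec c n 0 ≠ 0) :
    NonvanishingOnDisc (polyOf j (schurVec c n)) ↔ ∀ i, n ≤ i → i < n + j → 0 < schurRatio c i := by
  induction j generalizing n with
  | zero => exact iff_of_true (nonvanishingOnDisc_polyOf_zero h0) fun i hi hi' => by omega
  | succ j ih =>
    have e : 2 * g - 1 - n = j + 1 := by omega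
    have hs : mixReverse (j + 1) (endRatio (j + 1) (schurVec c n)) (schurVec c n) =
      schurVec c (n + 1) := by rw [schurVec_succ, schurRatio, e]
    have hr : endRatio (j + 1) (schurVec c n) = schurRatio c n := by rw [schurRatio, e]
    rw [nonvanishingOnDisc_polyOf_succ_iff, hs, hr]
    constructor
    · rintro ⟨h1, h2⟩ i hi hi'
      rcases hi.eq_or_lt with rfl | hi
      · exact h1
      · exact (ih (n + 1) (by omega) (schurVec_succ_zero_ne_zero h1)).1 h2 i hi (by omega)
    · intro h
      have h1 := h n le_rfl (by omega)
      exact ⟨h1, (ih (n + 1) (by omega) (schurVec_succ_zero_ne_zero h1)).2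
        fun i hi hi' => h i (by omega) (by omega)⟩

theorem schurVec_zero_zero {g : ℕ} (hg : 0 < g) (c : Fin (g + 1) → ℝ) :
    schurVec c 0 0 = 2 * c 0 := by
  have : (g : ℝ) ≠ 0 := by exact_mod_cast hg.ne'
  have e : palCoeff c 0 = c 0 := by
    simp only [palCoeff]
    congr 1
  simp only [schurVec, e]
  push_cast
  field_simp
  ring

theorem nonvanishingOnDisc_schurVec_zero_iff {g : ℕ} (hg : 0 < g) {c : Fin (g + 1) → ℝ}
    (hc : c 0 ≠ 0) : NonvanishingOnDisc (polyOf (2 * g - 1) (schurVec c 0)) ↔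
      ∀ n < 2 * g - 1, 0 < schurRatio c n := by
  rw [nonvanishingOnDisc_schurVec_iff_add c _ 0 (by omega)
    (by rw [schurVec_zero_zero hg]; exact mul_ne_zero two_ne_zero hc)]
  exact forall_congr' fun n => by simp

theorem zerosOnCircleSimple_selfRecPoly_iff {g : ℕ} (hg : 0 < g) {c : Fin (g + 1) → ℝ}
    (hc : c 0 ≠ 0) : ZerosOnCircleSimple (selfRecPoly g c) ↔
      ∀ n < 2 * g - 1, 0 < schurRatio c n := by
  rw [← nonvanishingOnDisc_schurVec_zero_iff hg hc, selfRecPoly_eq_polyOf]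
  refine zerosOnCircleSimple_iff hg ?_ fun i hi => palCoeff_sub c hi
  have e : palCoeff c 0 = c 0 := by
    simp only [palCoeff]
    congr 1
  rwa [e]

/-! ### Values of rational functions -/

namespace HasValueAt

variable {g : ℕ} {r r' : RatFun ℚ g} {c : Fin (g + 1) → ℝ} {y y' : ℝ}

theorem algebraMap_ne_zero {s : MvPolynomial (Fin (g + 1)) ℚ}
    (h : MvPolynomial.aeval c s ≠ 0) : algebraMap _ (RatFun ℚ g) s ≠ 0 := by
  intro h0
  rw [FaithfulSMul.algebraMap_eq_zero_iff] at h0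
  exact h (by rw [h0, map_zero])

theorem unique (h : HasValueAt r c y) (h' : HasValueAt r c y') : y = y' := by
  obtain ⟨p, s, hs, rfl, rfl⟩ := h
  obtain ⟨p', s', hs', e, rfl⟩ := h'
  rw [div_eq_div_iff (algebraMap_ne_zero hs) (algebraMap_ne_zero hs'), ← map_mul, ← map_mul] at e
  have := congrArg (MvPolynomial.aeval c) (FaithfulSMul.algebraMap_injective _ _ e)
  rw [map_mul, map_mul] at this
  rwa [div_eq_div_iff hs hs']

theorem of_polynomial (p : MvPolynomial (Fin (g + 1)) ℚ) :
    HasValueAt (algebraMap _ (RatFun ℚ g) p) c (MvPolynomial.aeval c p) :=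
  ⟨p, 1, by simp, by simp, by simp⟩

theorem ratCast (x : ℚ) : HasValueAt (x : RatFun ℚ g) c x := by
  have h := of_polynomial (c := c) (MvPolynomial.C x)
  have e : algebraMap (MvPolynomial (Fin (g + 1)) ℚ) (RatFun ℚ g) (MvPolynomial.C x) = (x : RatFun ℚ g) :=
    map_ratCast ((algebraMap (MvPolynomial (Fin (g + 1)) ℚ) (RatFun ℚ g)).comp MvPolynomial.C) x
  rw [e, MvPolynomial.aeval_C] at h
  exact h

theorem one : HasValueAt (1 : RatFun ℚ g) c 1 := by simpa using ratCast (c := c) 1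

theorem add (h : HasValueAt r c y) (h' : HasValueAt r' c y') :
    HasValueAt (r + r') c (y + y') := by
  obtain ⟨p, s, hs, rfl, rfl⟩ := h
  obtain ⟨p', s', hs', rfl, rfl⟩ := h'
  refine ⟨p * s' + s * p', s * s', by rw [map_mul]; exact mul_ne_zero hs hs', ?_, ?_⟩
  · rw [div_add_div _ _ (algebraMap_ne_zero hs) (algebraMap_ne_zero hs')]
    simp only [map_add, map_mul]
  · rw [div_add_div _ _ hs hs']
    simp only [map_add, map_mul]

theorem mul (h : HasValueAt r c y) (h' : HasValueAt r' c y') :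
    HasValueAt (r * r') c (y * y') := by
  obtain ⟨p, s, hs, rfl, rfl⟩ := h
  obtain ⟨p', s', hs', rfl, rfl⟩ := h'
  refine ⟨p * p', s * s', by rw [map_mul]; exact mul_ne_zero hs hs', ?_, ?_⟩
  · rw [div_mul_div_comm]
    simp only [map_mul]
  · rw [div_mul_div_comm]
    simp only [map_mul]

theorem inv (h : HasValueAt r c y) (hy : y ≠ 0) : HasValueAt r⁻¹ c y⁻¹ := by
  obtain ⟨p, s, hs, rfl, rfl⟩ := h
  exact ⟨s, p, fun h0 => hy (by rw [h0, zero_div]), inv_div _ _, inv_div _ _⟩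

theorem div (h : HasValueAt r c y) (h' : HasValueAt r' c y') (hy : y' ≠ 0) :
    HasValueAt (r / r') c (y / y') := by
  rw [div_eq_mul_inv, div_eq_mul_inv]
  exact h.mul (h'.inv hy)

theorem sub (h : HasValueAt r c y) (h' : HasValueAt r' c y') :
    HasValueAt (r - r') c (y - y') := by
  have := h.add ((ratCast (-1)).mul h')
  simpa [sub_eq_add_neg] using this

theorem ne_zero (h : HasValueAt r c y) (hy : y ≠ 0) : r ≠ 0 := by
  rintro rfl
  refine hy (h.unique ?_)
  simpa using ratCast (g := g) (c := c) 0

theorem mixReverse {a : ℕ → RatFun ℚ g} {b : ℕ → ℝ} (h : ∀ i, HasValueAt (a i) c (b i))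
    (hr : HasValueAt r c y) (N i : ℕ) :
    HasValueAt (mixReverse N r a i) c (mixReverse N y b i) := by
  refine ((((one.add hr).mul (h _)).add ((one.sub hr).mul (h _))).div ?_ two_ne_zero)
  simpa using ratCast (g := g) (c := c) 2

end HasValueAt

theorem PosAt.inv {g : ℕ} {r : RatFun ℚ g} {c : Fin (g + 1) → ℝ} (h : PosAt r c) :
    PosAt r⁻¹ c := by
  obtain ⟨y, h, hy⟩ := h
  exact ⟨y⁻¹, h.inv hy.ne', inv_pos.2 hy⟩

theorem PosAt.mul {g : ℕ} {r s : RatFun ℚ g} {c : Fin (g + 1) → ℝ} (h : PosAt r c)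
    (h' : PosAt s c) : PosAt (r * s) c := by
  obtain ⟨y, h, hy⟩ := h
  obtain ⟨y', h', hy'⟩ := h'
  exact ⟨y * y', h.mul h', mul_pos hy hy'⟩

theorem PosAt.ne_zero {g : ℕ} {r : RatFun ℚ g} {c : Fin (g + 1) → ℝ} (h : PosAt r c) : r ≠ 0 := by
  obtain ⟨y, h, hy⟩ := h
  exact h.ne_zero hy.ne'

theorem posAt_one {g : ℕ} {c : Fin (g + 1) → ℝ} : PosAt (1 : RatFun ℚ g) c :=
  ⟨1, HasValueAt.one, one_pos⟩

/-- The indeterminates `c_0, …, c_g` of `ℚ(c_0, …, c_g)`. -/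
noncomputable def indet (g : ℕ) (i : Fin (g + 1)) : RatFun ℚ g :=
  algebraMap (MvPolynomial (Fin (g + 1)) ℚ) (RatFun ℚ g) (MvPolynomial.X i)

theorem hasValueAt_indet {g : ℕ} (c : Fin (g + 1) → ℝ) (i : Fin (g + 1)) :
    HasValueAt (indet g i) c (c i) := by
  have h := HasValueAt.of_polynomial (c := c) (MvPolynomial.X i)
  rwa [MvPolynomial.aeval_X] at h

theorem hasValueAt_schurVec_zero {g : ℕ} (hg : 0 < g) (c : Fin (g + 1) → ℝ) (i : ℕ) :
    HasValueAt (schurVec (indet g) 0 i) c (schurVec c 0 i) := by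
  have hg' : (g : ℝ) ≠ 0 := by exact_mod_cast hg.ne'
  have nat (n : ℕ) : HasValueAt (n : RatFun ℚ g) c n := by
    simpa using HasValueAt.ratCast (g := g) (c := c) n
  exact (((nat _).sub (nat _)).div (nat _) hg').mul (hasValueAt_indet c _)

theorem hasValueAt_schurRatio {g : ℕ} {c : Fin (g + 1) → ℝ} {n : ℕ}
    (h : ∀ i, HasValueAt (schurVec (indet g) n i) c (schurVec c n i))
    (hp : 0 < schurRatio c n) : HasValueAt (schurRatio (indet g) n) c (schurRatio c n) :=
  ((h _).add (h _)).div ((h _).sub (h _)) (sub_ne_zero_of_endRatio_pos hp)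

theorem hasValueAt_schurVec {g : ℕ} (hg : 0 < g) {c : Fin (g + 1) → ℝ} (n : ℕ)
    (hp : ∀ k < n, 0 < schurRatio c k) (i : ℕ) :
    HasValueAt (schurVec (indet g) n i) c (schurVec c n i) := by
  induction n generalizing i with
  | zero => exact hasValueAt_schurVec_zero hg c i
  | succ n ih =>
    have ih := ih fun k hk => hp k (by omega)
    exact HasValueAt.mixReverse ih (hasValueAt_schurRatio ih (hp n (by omega))) _ _

/-- A rational Schur–Cohn ratio with a positive value takes there the Schur–Cohn ratio of the
values. -/
theorem schurRatio_pos_of_posAt {g : ℕ} {c : Fin (g + 1) → ℝ} {n : ℕ}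
    (hd : schurVec (indet g) n 0 - schurVec (indet g) n (2 * g - 1 - n) ≠ 0)
    (h : ∀ i, HasValueAt (schurVec (indet g) n i) c (schurVec c n i))
    (h0 : schurVec c n 0 ≠ 0) (hp : PosAt (schurRatio (indet g) n) c) : 0 < schurRatio c n := by
  obtain ⟨y, hy, hpos⟩ := hp
  -- After cancellation the rational function may be defined at `c` although its displayed
  -- denominator vanishes there. Clearing denominators gives `y (a_0 - a_N) = a_0 + a_N` for the
  -- values, so `a_0 = a_N` would force `a_0 = 0`.
  have h1 := hy.mul ((h 0).sub (h (2 * g - 1 - n)))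
  rw [schurRatio, endRatio, div_mul_cancel₀ _ hd] at h1
  have h2 := h1.unique ((h 0).add (h (2 * g - 1 - n)))
  have h3 : schurVec c n 0 - schurVec c n (2 * g - 1 - n) ≠ 0 := by
    intro h3
    rw [h3, mul_zero] at h2
    exact h0 (by linarith)
  rw [schurRatio, endRatio, ← h2, mul_div_cancel_right₀ _ h3]
  exact hpos

/-! ### Generic nonvanishing and the passage to rational functions -/

/-- At `c = (1, 0, …, 0)` the recursion starts from the constant polynomial `2`. This one point
certifies that no denominator or ratio of the generic recursion is identically zero. -/
theorem schurRatio_single_pos {g : ℕ} (hg : 0 < g) {n : ℕ} (hn : n < 2 * g - 1) :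
    0 < schurRatio (Pi.single 0 1 : Fin (g + 1) → ℝ) n := by
  refine (nonvanishingOnDisc_schurVec_zero_iff hg (by simp)).1 ?_ n hn
  intro z _
  have e : ∀ i ≤ 2 * g - 1, schurVec (Pi.single 0 1 : Fin (g + 1) → ℝ) 0 i =
      if i = 0 then 2 else 0 := by
    intro i hi
    split_ifs with h
    · rw [h, schurVec_zero_zero hg]
      simp
    · simp only [schurVec, palCoeff]
      rw [Pi.single_eq_of_ne, mul_zero]
      intro h'
      have := congrArg Fin.val h'
      simp only [Fin.val_zero] at this
      omega
  rw [polyOf_congr e, aeval_polyOf, Finset.sum_eq_single 0]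
  · simp
  · intro i _ hi
    simp [hi]
  · simp

theorem schurVec_indet_sub_ne_zero {g : ℕ} (hg : 0 < g) {n : ℕ} (hn : n < 2 * g - 1) :
    schurVec (indet g) n 0 - schurVec (indet g) n (2 * g - 1 - n) ≠ 0 := by
  have h := hasValueAt_schurVec hg (c := Pi.single 0 1) n
    fun k hk => schurRatio_single_pos hg (by omega)
  exact ((h _).sub (h _)).ne_zero (sub_ne_zero_of_endRatio_pos (schurRatio_single_pos hg hn))

theorem schurRatio_indet_ne_zero {g : ℕ} (hg : 0 < g) {n : ℕ} (hn : n < 2 * g - 1) :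
    schurRatio (indet g) n ≠ 0 :=
  (hasValueAt_schurRatio (hasValueAt_schurVec hg (c := Pi.single 0 1) n
    fun k hk => schurRatio_single_pos hg (by omega)) (schurRatio_single_pos hg hn)).ne_zero
    (schurRatio_single_pos hg hn).ne'

theorem indet_zero_ne_zero (g : ℕ) : indet g 0 ≠ 0 :=
  (hasValueAt_indet (Pi.single 0 1) 0).ne_zero (by simp)

theorem forall_schurRatio_pos_iff {g : ℕ} (hg : 0 < g) {c : Fin (g + 1) → ℝ} (hc : c 0 ≠ 0) :
    (∀ n < 2 * g - 1, 0 < schurRatio c n) ↔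
      ∀ n < 2 * g - 1, PosAt (schurRatio (indet g) n) c := by
  constructor
  · intro h n hn
    exact ⟨_, hasValueAt_schurRatio (hasValueAt_schurVec hg n fun k hk => h k (by omega)) (h n hn),
      h n hn⟩
  · intro h n
    induction n using Nat.strong_induction_on with
    | _ n ih =>
      intro hn
      have ih' : ∀ k < n, 0 < schurRatio c k := fun k hk => ih k hk (by omega)
      refine schurRatio_pos_of_posAt (schurVec_indet_sub_ne_zero hg hn)
        (hasValueAt_schurVec hg n ih') ?_ (h n hn)
      cases n with
      | zero =>
        rw [schurVec_zero_zero hg]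
        exact mul_ne_zero two_ne_zero hc
      | succ n => exact schurVec_succ_zero_ne_zero (ih' n (by omega))

/-- The rational functions `R_n`. -/
noncomputable def ratR (g : ℕ) : ℕ → RatFun ℚ g
  | 0 => 1
  | 1 => 1
  | n + 2 => ratR g n * schurRatio (indet g) n

theorem forall_posAt_ratR_iff {g : ℕ} (hg : 0 < g) (c : Fin (g + 1) → ℝ) :
    (∀ n, 1 ≤ n → n ≤ 2 * g → PosAt (ratR g n) c ∧ PosAt (ratR g n)⁻¹ c) ↔
      ∀ n < 2 * g - 1, PosAt (schurRatio (indet g) n) c := by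
  constructor
  · intro h n hn
    have h0 : PosAt (ratR g n) c := by
      cases n with
      | zero => exact posAt_one
      | succ n => exact (h (n + 1) (by omega) (by omega)).1
    have := h0.inv.mul (h (n + 2) (by omega) (by omega)).1
    rwa [ratR, inv_mul_cancel_left₀ h0.ne_zero] at this
  · intro h
    have key : ∀ n, n ≤ 2 * g → PosAt (ratR g n) c := by
      intro n
      induction n using Nat.strong_induction_on with
      | _ n ih =>
        intro hn
        match n with
        | 0 => exact posAt_one
        | 1 => exact posAt_one
        | n + 2 => exact (ih n (by omega) (by omega)).mul (h n (by omega))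
    exact fun n _ hn => ⟨key n hn, (key n hn).inv⟩

/-! ### The linear step -/

/-- The concatenation of a vector `a` of length `M` with a vector `b`. -/
def pairVec {K : Type*} (M : ℕ) (a b : ℕ → K) : ℕ → K := fun s =>
  if s < M then a s else b (s - M)

/-- Component `i` of the product of the pattern `[1 at j = i, e at i + j = k + 1]` with `f`. -/
def rowVal {K : Type*} [Field K] (e : K) (k : ℕ) (f : ℕ → K) (i : ℕ) : K :=
  if 2 * i = k + 1 then f i else f i + e * f (k + 1 - i)

section

variable {K : Type*} [Field K]

theorem sum_pattern_mul (e : K) (k : ℕ) (f : ℕ → K) {i : ℕ} (hi : 2 * i ≤ k + 1) :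
    ∑ s ∈ Finset.range (k + 2), (if i = s then 1 else if i + s = k + 1 then e else 0) * f s =
      rowVal e k f i := by
  have h : ∀ s ∈ Finset.range (k + 2),
      (if i = s then 1 else if i + s = k + 1 then e else 0) * f s =
        (if s = i then f s else 0) + if s = k + 1 - i then
          (if 2 * i = k + 1 then 0 else e * f s) else 0 := by
    intro s _
    by_cases h1 : s = i
    · subst h1
      by_cases h2 : 2 * s = k + 1
      · simp [h2]
      · simp [show s ≠ k + 1 - s by omega]
    · by_cases h2 : s = k + 1 - i
      · simp [Ne.symm h1, h1, show i + s = k + 1 by omega, show 2 * i ≠ k + 1 by omega, ← h2]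
      · simp [Ne.symm h1, h1, show i + s ≠ k + 1 by omega, h2]
  rw [Finset.sum_congr rfl h, Finset.sum_add_distrib, Finset.sum_ite_eq', Finset.sum_ite_eq',
    if_pos (Finset.mem_range.2 (by omega)), if_pos (Finset.mem_range.2 (by omega)), rowVal]
  split_ifs <;> simp

theorem sum_entryPlus_mul (k : ℕ) (f : ℕ → K) {i : ℕ} (hi : 2 * i ≤ k + 1) :
    ∑ s ∈ Finset.range (k + 2), entryPlus K k i s * f s = rowVal 1 k f i :=
  sum_pattern_mul 1 k f hi

theorem sum_entryMinus_mul (k : ℕ) (f : ℕ → K) {i : ℕ} (hi : 2 * i ≤ k + 1) :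
    ∑ s ∈ Finset.range (k + 2), entryMinus K k i s * f s = rowVal (-1) k f i :=
  sum_pattern_mul (-1) k f hi

theorem sum_fin_pairVec (M n : ℕ) (hn : n = M + M) (x : ℕ → K) (a b : ℕ → K) :
    ∑ s : Fin n, x s * pairVec M a b s =
      ∑ s ∈ Finset.range M, x s * a s + ∑ s ∈ Finset.range M, x (M + s) * b s := by
  subst hn
  rw [Fin.sum_univ_eq_sum_range (fun s => x s * pairVec M a b s), Finset.sum_range_add]
  congr 1
  · refine Finset.sum_congr rfl fun s hs => ?_
    rw [pairVec, if_pos (Finset.mem_range.1 hs)]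
  · refine Finset.sum_congr rfl fun s _ => ?_
    rw [pairVec, if_neg (by omega), Nat.add_sub_cancel_left]

theorem matQ_mulVec_pairVec (k : ℕ) (a b : ℕ → K) (r : Fin (2 * k + 2)) :
    Matrix.mulVec (matQ K k) (fun s => pairVec (k + 2) a b s) r =
      if (r : ℕ) < rowsPlus k then rowVal 1 k a r
      else if (r : ℕ) < k + 2 then rowVal (-1) k b (r - rowsPlus k) else 0 := by
  have hsum := sum_fin_pairVec (k + 2) (2 * k + 4) (by ring) (fun s =>
    if (r : ℕ) < rowsPlus k then (if s < k + 2 then entryPlus K k r s else 0)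
    else if (r : ℕ) < k + 2 then
      (if s < k + 2 then 0 else entryMinus K k (r - rowsPlus k) (s - (k + 2)))
    else 0) a b
  rw [Matrix.mulVec, dotProduct]
  simp only [matQ]
  rw [hsum]
  have hrow : rowsPlus k = (k + 3) / 2 := rfl
  split_ifs with h1 h2
  · rw [← sum_entryPlus_mul k a (by omega)]
    refine (congrArg₂ (· + ·) ?_ ?_).trans (add_zero _)
    · exact Finset.sum_congr rfl fun s hs => by rw [if_pos (Finset.mem_range.1 hs)]
    · exact Finset.sum_eq_zero fun s _ => by rw [if_neg (by omega), zero_mul]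
  · rw [← sum_entryMinus_mul k b (by omega)]
    refine (congrArg₂ (· + ·) ?_ ?_).trans (zero_add _)
    · exact Finset.sum_eq_zero fun s hs => by rw [if_pos (Finset.mem_range.1 hs), zero_mul]
    · exact Finset.sum_congr rfl fun s _ => by rw [if_neg (by omega), Nat.add_sub_cancel_left]
  · simp

/-- Padding both halves by a zero at index `k + 1` makes up for the column that `V` lacks compared
with `W`, so that `P` and `Q` share one row formula. -/
theorem matP_mulVec_pairVec (k : ℕ) (m : K) {a b : ℕ → K} (ha : a (k + 1) = 0)
    (hb : b (k + 1) = 0) (r : Fin (2 * k + 2)) :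
    Matrix.mulVec (matP k m) (fun s => pairVec (k + 1) a b s) r =
      if (r : ℕ) < rowsPlus k then rowVal 1 k a r
      else if (r : ℕ) < k + 2 then rowVal (-1) k b (r - rowsPlus k)
      else a (r - (k + 2) + 1) - m * b (r - (k + 2) + 1) := by
  have hsum := sum_fin_pairVec (k + 1) (2 * k + 2) (by ring) (fun s =>
    if (r : ℕ) < rowsPlus k then (if s < k + 1 then entryPlus K k r s else 0)
    else if (r : ℕ) < k + 2 then
      (if s < k + 1 then 0 else entryMinus K k (r - rowsPlus k) (s - (k + 1)))
    else if s = (r - (k + 2)) + 1 then 1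
    else if s = (k + 1) + ((r - (k + 2)) + 1) then -m
    else 0) a b
  rw [Matrix.mulVec, dotProduct]
  simp only [matP]
  rw [hsum]
  have hrow : rowsPlus k = (k + 3) / 2 := rfl
  have hr := r.2
  split_ifs with h1 h2
  · rw [← sum_entryPlus_mul k a (by omega), Finset.sum_range_succ _ (k + 1), ha, mul_zero]
    congr 1
    · exact Finset.sum_congr rfl fun s hs => by rw [if_pos (Finset.mem_range.1 hs)]
    · exact Finset.sum_eq_zero fun s _ => by rw [if_neg (by omega), zero_mul]
  · rw [← sum_entryMinus_mul k b (by omega), Finset.sum_range_succ _ (k + 1), hb, mul_zero,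
      add_comm]
    congr 1
    · exact Finset.sum_congr rfl fun s _ => by rw [if_neg (by omega), Nat.add_sub_cancel_left]
    · exact Finset.sum_eq_zero fun s hs => by rw [if_pos (Finset.mem_range.1 hs), zero_mul]
  · rw [sub_eq_add_neg, ← neg_mul]
    congr 1
    · rw [Finset.sum_eq_single ((r : ℕ) - (k + 2) + 1)]
      · rw [if_pos rfl, one_mul]
      · intro s hs hne
        rw [Finset.mem_range] at hs
        rw [if_neg hne, if_neg (by omega), zero_mul]
      · intro h
        exact absurd (Finset.mem_range.2 (by omega)) h
    · rw [Finset.sum_eq_single ((r : ℕ) - (k + 2) + 1)]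
      · rw [if_neg (by omega), if_pos rfl]
      · intro s hs hne
        rw [if_neg (by omega), if_neg (by omega), zero_mul]
      · intro h
        exact absurd (Finset.mem_range.2 (by omega)) h

/-- The indices `j` and `k + 1 - j` decouple into pairs: the sum of the `a`'s is zero, the `b`'s
agree, and `a = m b`, whence `2 m b_j = 0`. For `j = 0` the partner is the padding zero; a middle
index is settled by its plus row and `a = m b`. -/
theorem eq_zero_of_rowVal_eq_zero [NeZero (2 : K)] {k : ℕ} {m : K} (hm : m ≠ 0) {a b : ℕ → K}
    (ha : a (k + 1) = 0) (hb : b (k + 1) = 0)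
    (h1 : ∀ i, 2 * i ≤ k + 1 → rowVal 1 k a i = 0) (h2 : ∀ i, 2 * i ≤ k → rowVal (-1) k b i = 0)
    (h3 : ∀ i, 1 ≤ i → i ≤ k → a i = m * b i) {i : ℕ} (hi : i ≤ k) : a i = 0 ∧ b i = 0 := by
  have two : (2 : K) ≠ 0 := NeZero.ne _
  have low : ∀ j, 2 * j ≤ k + 1 → (a j = 0 ∧ b j = 0) ∧ (a (k + 1 - j) = 0 ∧ b (k + 1 - j) = 0) := by
    intro j hj
    have e1 := h1 j hj
    rw [rowVal] at e1
    split_ifs at e1 with hjk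
    · have e : k + 1 - j = j := by omega
      rw [e]
      have e3 := h3 j (by omega) (by omega)
      rw [e1, eq_comm, mul_eq_zero] at e3
      exact ⟨⟨e1, e3.resolve_left hm⟩, e1, e3.resolve_left hm⟩
    · have e2 := h2 j (by omega)
      rw [rowVal, if_neg hjk] at e2
      rcases Nat.eq_zero_or_pos j with rfl | hj0
      · rw [Nat.sub_zero] at *
        rw [ha] at e1
        rw [hb] at e2
        exact ⟨⟨by simpa using e1, by simpa using e2⟩, ha, hb⟩
      · have e3 := h3 j (by omega) (by omega)
        have e4 := h3 (k + 1 - j) (by omega) (by omega)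
        have e5 : b j = 0 := by
          have : (2 * m) * b j = 0 := by linear_combination e1 - e3 - e4 + m * e2
          exact (mul_eq_zero.1 this).resolve_left (mul_ne_zero two hm)
        have e6 : b (k + 1 - j) = 0 := by linear_combination e5 - e2
        exact ⟨⟨by rw [e3, e5, mul_zero], e5⟩, by rw [e4, e6, mul_zero], e6⟩
  rcases le_or_gt (2 * i) (k + 1) with h | h
  · exact (low i h).1
  · have := (low (k + 1 - i) (by omega)).2
    rwa [show k + 1 - (k + 1 - i) = i by omega] at this

theorem isUnit_matP [NeZero (2 : K)] (k : ℕ) {m : K} (hm : m ≠ 0) : IsUnit (matP k m) := by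
  rw [← Matrix.mulVec_injective_iff_isUnit]
  refine (injective_iff_map_eq_zero (Matrix.mulVecLin (matP k m))).2 fun x hx => ?_
  rw [Matrix.mulVecLin_apply] at hx
  set a : ℕ → K := fun i => if h : i < k + 1 then x ⟨i, by omega⟩ else 0 with ha
  set b : ℕ → K := fun i => if h : i < k + 1 then x ⟨k + 1 + i, by omega⟩ else 0 with hb
  have ha0 : a (k + 1) = 0 := dif_neg (by omega)
  have hb0 : b (k + 1) = 0 := dif_neg (by omega)
  have hxe : x = fun s : Fin (2 * k + 2) => pairVec (k + 1) a b s := by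
    ext s
    have hs := s.2
    simp only [pairVec, ha, hb]
    split_ifs with h1 h2
    · rfl
    · congr 1
      ext
      simp only
      omega
    · omega
  rw [hxe] at hx
  have hr : ∀ r (h : r < 2 * k + 2), _ = (0 : K) := fun r h =>
    (matP_mulVec_pairVec k m ha0 hb0 ⟨r, h⟩).symm.trans (congrFun hx ⟨r, h⟩)
  simp only at hr
  have hrow : rowsPlus k = (k + 3) / 2 := rfl
  have key : ∀ i ≤ k, a i = 0 ∧ b i = 0 := by
    refine fun i hi => eq_zero_of_rowVal_eq_zero hm ha0 hb0 (fun i hi => ?_) (fun i hi => ?_)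
      (fun i hi hi' => ?_) hi
    · have := hr i (by omega)
      rwa [if_pos (by omega)] at this
    · have := hr (rowsPlus k + i) (by omega)
      rwa [if_neg (by omega), if_pos (by omega), Nat.add_sub_cancel_left] at this
    · have := hr (k + 2 + (i - 1)) (by omega)
      rw [if_neg (by omega), if_neg (by omega), Nat.add_sub_cancel_left,
        Nat.sub_add_cancel hi] at this
      exact sub_eq_zero.1 this
  rw [hxe]
  ext s
  have hs := s.2
  rw [pairVec]
  split_ifs with h
  · exact (key _ (by omega)).1
  · exact (key _ (by omega)).2

theorem ratio_eq_of_pairVec {k : ℕ} {w a b : ℕ → K}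
    (hw : ∀ j < 2 * k + 4, w (j + 1) = pairVec (k + 2) a b j) :
    ratio k w = (a 0 + a (k + 1)) / (b 0 - b (k + 1)) := by
  rw [ratio, hw 0 (by omega), hw (k + 1) (by omega), hw (k + 2) (by omega),
    hw (2 * k + 3) (by omega)]
  simp only [pairVec]
  rw [if_pos (by omega), if_pos (by omega), if_neg (by omega), if_neg (by omega), Nat.sub_self,
    show 2 * k + 3 - (k + 2) = k + 1 by omega]

/-- The first half of the vector produced by one step of the linear system. -/
def stepHead (k : ℕ) (m : K) (a b : ℕ → K) : ℕ → K := fun i =>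
  (a i + a (k + 1 - i) + m * (b i - b (k + 1 - i))) / 2

/-- The candidate `(a', a'/m)` keeps the palindromic part of `a` and the antipalindromic part of
`b`, as the `V` and `W` rows demand, and satisfies the `J` rows by its shape. The value `m = ratio k
w` is exactly what makes `a'` vanish at `k + 1`. Invertibility of `P` then identifies it with the
step. -/
theorem step_eq_pairVec [NeZero (2 : K)] {k : ℕ} {w a b : ℕ → K}
    (hw : ∀ j < 2 * k + 4, w (j + 1) = pairVec (k + 2) a b j) (hm : ratio k w ≠ 0) {j : ℕ}
    (hj : j < 2 * k + 2) :
    step k w (j + 1) = pairVec (k + 1) (stepHead k (ratio k w) a b)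
      (fun i => stepHead k (ratio k w) a b i / ratio k w) j := by
  have two : (2 : K) ≠ 0 := NeZero.ne _
  set m := ratio k w with hmdef
  set a' := stepHead k m a b with ha'
  have hratio : m = (a 0 + a (k + 1)) / (b 0 - b (k + 1)) := ratio_eq_of_pairVec hw
  have hd : b 0 - b (k + 1) ≠ 0 := by
    intro h
    rw [hratio, h, div_zero] at hm
    exact hm rfl
  have hlast : a' (k + 1) = 0 := by
    have h : m * (b 0 - b (k + 1)) = a 0 + a (k + 1) := by rw [hratio, div_mul_cancel₀ _ hd]
    simp only [ha', stepHead, Nat.sub_self]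
    rw [div_eq_zero_iff]
    left
    linear_combination -h
  have hPQ : Matrix.mulVec (matP k m) (fun s : Fin (2 * k + 2) =>
      pairVec (k + 1) a' (fun i => a' i / m) s) =
      Matrix.mulVec (matQ K k) (fun s : Fin (2 * k + 4) => pairVec (k + 2) a b s) := by
    ext r
    have hrow : rowsPlus k = (k + 3) / 2 := rfl
    rw [matP_mulVec_pairVec k m hlast (by rw [hlast, zero_div]), matQ_mulVec_pairVec]
    split_ifs with h1 h2
    · rw [rowVal, rowVal]
      simp only [ha', stepHead]
      rw [show k + 1 - (k + 1 - (r : ℕ)) = r by omega]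
      split_ifs with h3
      · rw [show k + 1 - (r : ℕ) = r by omega]
        field_simp
        ring
      · field_simp
        ring
    · rw [rowVal, rowVal, if_neg (by omega), if_neg (by omega)]
      simp only [ha', stepHead]
      rw [show k + 1 - (k + 1 - ((r : ℕ) - rowsPlus k)) = r - rowsPlus k by omega]
      field_simp
      ring
    · rw [mul_div_cancel₀ _ hm, sub_self]
  have hwv : (fun i : Fin (2 * k + 4) => w ((i : ℕ) + 1)) =
      fun s : Fin (2 * k + 4) => pairVec (k + 2) a b s :=
    funext fun i => hw i i.2
  rw [step, dif_pos ⟨by omega, by omega⟩, ← hmdef, hwv, ← hPQ, Matrix.mulVec_mulVec,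
    Matrix.nonsing_inv_mul _ ((Matrix.isUnit_iff_isUnit_det _).1 (isUnit_matP k hm)),
    Matrix.one_mulVec]
  rfl

end

/-! ### The vectors of the linear system -/

theorem ratToReal_indet (g : ℕ) (i : Fin (g + 1)) : ratToReal g (indet g i) =
    algebraMap (MvPolynomial (Fin (g + 1)) ℝ) (RatFun ℝ g) (MvPolynomial.X i) := by
  rw [ratToReal, IsFractionRing.map, indet, IsLocalization.map_eq, MvPolynomial.map_X]

theorem ratToReal_palCoeff_indet (g i : ℕ) :
    ratToReal g (palCoeff (indet g) i) = coeffVar g i := ratToReal_indet g _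

/-- The value of `m_{2g-1-n}` predicted by the Schur–Cohn recursion. -/
noncomputable def schurM (g : ℕ) (q : ℝ) : ℕ → RatFun ℝ g
  | 0 => algebraMap ℝ (RatFun ℝ g) (1 / ((g : ℝ) * Real.log q))
  | n + 1 => ratToReal g (schurRatio (indet g) n) * schurM g q n

theorem algebraMap_real_ne_zero (g : ℕ) {x : ℝ} (hx : x ≠ 0) :
    algebraMap ℝ (RatFun ℝ g) x ≠ 0 := by
  rw [Ne, map_eq_zero]
  exact hx

theorem one_div_mul_log_ne_zero {g : ℕ} (hg : 0 < g) {q : ℝ} (hq : 1 < q) :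
    1 / ((g : ℝ) * Real.log q) ≠ 0 := by
  have hg' : (g : ℝ) ≠ 0 := by exact_mod_cast hg.ne'
  exact one_div_ne_zero (mul_ne_zero hg' (Real.log_pos hq).ne')

theorem schurM_ne_zero {g : ℕ} (hg : 0 < g) {q : ℝ} (hq : 1 < q) {n : ℕ} (hn : n ≤ 2 * g - 1) :
    schurM g q n ≠ 0 := by
  induction n with
  | zero => exact algebraMap_real_ne_zero g (one_div_mul_log_ne_zero hg hq)
  | succ n ih =>
    refine mul_ne_zero ?_ (ih (by omega))
    rw [Ne, map_eq_zero]
    exact schurRatio_indet_ne_zero hg (by omega)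

/-- The second half of the initial vector. -/
noncomputable def initTail (g : ℕ) (q : ℝ) (i : ℕ) : RatFun ℝ g :=
  coeffVar g i * algebraMap ℝ (RatFun ℝ g) (((g : ℝ) - i) * Real.log q)

theorem initVec_succ (g : ℕ) (q : ℝ) (j : ℕ) :
    initVec g q (j + 1) = pairVec (2 * g + 1) (coeffVar g) (initTail g q) j := by
  rw [initVec, pairVec]
  split_ifs with h1 h2 h2
  · rfl
  · omega
  · omega
  · rw [initTail, show j + 1 - (2 * g + 2) = j - (2 * g + 1) by omega, Real.log_zpow]
    push_cast
    rfl

theorem coeffVar_sub {g i : ℕ} (hi : i ≤ 2 * g) : coeffVar g (2 * g - i) = coeffVar g i := by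
  rw [← ratToReal_palCoeff_indet, ← ratToReal_palCoeff_indet, palCoeff_sub _ hi]

theorem coeffVar_zero_ne_zero (g : ℕ) : coeffVar g 0 ≠ 0 := by
  rw [← ratToReal_palCoeff_indet, Ne, map_eq_zero]
  have e : palCoeff (indet g) 0 = indet g 0 := by
    simp only [palCoeff]
    congr 1
  rw [e]
  exact indet_zero_ne_zero g

/-- Thus `m_{2g-1} = m_{2g}`, which is why `R_1 = 1`. -/
theorem ratio_initVec {g : ℕ} (hg : 0 < g) {q : ℝ} (hq : 1 < q) :
    ratio (2 * g - 1) (initVec g q) = schurM g q 0 := by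
  have hg' : (g : ℝ) ≠ 0 := by exact_mod_cast hg.ne'
  have hl := (Real.log_pos hq).ne'
  have hc := coeffVar_zero_ne_zero g
  have hc2 := coeffVar_sub (g := g) (i := 0) (by omega)
  have hx := algebraMap_real_ne_zero g (mul_ne_zero hg' hl)
  have e : initTail g q 0 - initTail g q (2 * g) =
      (coeffVar g 0 + coeffVar g 0) * algebraMap ℝ (RatFun ℝ g) (g * Real.log q) := by
    rw [Nat.sub_zero] at hc2
    rw [initTail, initTail, hc2, ← mul_sub, ← map_sub, add_mul, ← mul_add, ← map_add]
    congr 2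
    push_cast
    ring
  rw [ratio_eq_of_pairVec (a := coeffVar g) (b := initTail g q) fun j _ => by
    rw [initVec_succ, show 2 * g - 1 + 2 = 2 * g + 1 by omega]]
  rw [Nat.sub_zero] at hc2
  rw [show 2 * g - 1 + 1 = 2 * g by omega, e, hc2, schurM, map_div₀, map_one, ← div_div,
    div_self]
  rw [← two_mul]
  exact mul_ne_zero two_ne_zero hc

theorem stepHead_init {g : ℕ} (hg : 0 < g) {q : ℝ} (hq : 1 < q) {i : ℕ} (hi : i ≤ 2 * g) :
    stepHead (2 * g - 1) (schurM g q 0) (coeffVar g) (initTail g q) i =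
      ratToReal g (schurVec (indet g) 0 i) := by
  have hg' : (g : ℝ) ≠ 0 := by exact_mod_cast hg.ne'
  have hgK : (g : RatFun ℝ g) ≠ 0 := by exact_mod_cast hg.ne'
  have hl := (Real.log_pos hq).ne'
  have hmul : ∀ x : ℝ, schurM g q 0 * (coeffVar g i * algebraMap ℝ (RatFun ℝ g) (x * Real.log q)) =
      coeffVar g i * algebraMap ℝ (RatFun ℝ g) (x / g) := by
    intro x
    rw [schurM, mul_left_comm, ← map_mul]
    congr 2
    field_simp
  rw [stepHead, show 2 * g - 1 + 1 = 2 * g by omega]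
  simp only [initTail, schurVec]
  rw [coeffVar_sub hi, mul_sub, hmul, hmul, Nat.cast_sub hi]
  simp only [map_mul, map_div₀, map_sub, map_natCast, ratToReal_palCoeff_indet]
  push_cast
  field_simp
  ring

theorem ratToReal_mixReverse (g : ℕ) (N : ℕ) (r : RatFun ℚ g) (a : ℕ → RatFun ℚ g) (i : ℕ) :
    ratToReal g (mixReverse N r a i) =
      mixReverse N (ratToReal g r) (fun i => ratToReal g (a i)) i := by
  simp only [mixReverse, map_div₀, map_add, map_sub, map_mul, map_one, map_ofNat]

/-- Since the second half is the first divided by `m`, the new quotient is `m` times the end ratio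
of the first half. -/
theorem ratio_of_pairVec_schurVec {g : ℕ} {q : ℝ} {n : ℕ} (hn : n + 1 ≤ 2 * g - 1)
    {w : ℕ → RatFun ℝ g} (hw : ∀ j < 2 * (2 * g - n), w (j + 1) = pairVec (2 * g - n)
      (fun i => ratToReal g (schurVec (indet g) n i))
      (fun i => ratToReal g (schurVec (indet g) n i) / schurM g q n) j) :
    ratio (2 * g - 1 - (n + 1)) w = schurM g q (n + 1) := by
  obtain ⟨k, hk⟩ : ∃ k, 2 * g - 1 - (n + 1) = k := ⟨_, rfl⟩
  rw [show 2 * g - n = k + 2 by omega] at hw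
  rw [hk, ratio_eq_of_pairVec fun j hj => hw j (by omega), schurM, schurRatio, endRatio,
    show 2 * g - 1 - n = k + 1 by omega, ← sub_div, map_div₀, map_add, map_sub, div_div_eq_mul_div,
    div_mul_eq_mul_div]

theorem vec_succ_eq_pairVec {g : ℕ} (hg : 0 < g) {q : ℝ} (hq : 1 < q) {n : ℕ}
    (hn : n ≤ 2 * g - 1) : ∀ j < 2 * (2 * g - n), vec g (initVec g q) (n + 1) (j + 1) =
      pairVec (2 * g - n) (fun i => ratToReal g (schurVec (indet g) n i))
        (fun i => ratToReal g (schurVec (indet g) n i) / schurM g q n) j := by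
  induction n with
  | zero =>
    intro j hj
    have hr := ratio_initVec hg hq
    rw [vec, vec, zero_add, step_eq_pairVec (a := coeffVar g) (b := initTail g q) (fun j _ => by
      rw [initVec_succ, show 2 * g - 1 + 2 = 2 * g + 1 by omega])
      (by rw [hr]; exact schurM_ne_zero hg hq hn) (by omega), hr,
      show 2 * g - 1 + 1 = 2 * g by omega, Nat.sub_zero, pairVec, pairVec]
    split_ifs with h
    · exact stepHead_init hg hq (by omega)
    · rw [stepHead_init hg hq (by omega)]
  | succ n ih =>
    intro j hj
    have ih := ih (by omega)
    have hr := ratio_of_pairVec_schurVec hn ih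
    have hM := schurM_ne_zero hg hq (show n ≤ 2 * g - 1 by omega)
    have hM' := schurM_ne_zero hg hq hn
    obtain ⟨k, hk⟩ : ∃ k, 2 * g - 1 - (n + 1) = k := ⟨_, rfl⟩
    rw [show 2 * g - n = k + 2 by omega] at ih
    rw [hk] at hr
    -- With `b = a/m` and new multiplier `r m`, the old `m` cancels and the step is mixing with
    -- ratio `r`.
    have hhead : ∀ i, stepHead k (schurM g q (n + 1))
        (fun i => ratToReal g (schurVec (indet g) n i))
        (fun i => ratToReal g (schurVec (indet g) n i) / schurM g q n) i =
        ratToReal g (schurVec (indet g) (n + 1) i) := by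
      intro i
      rw [schurVec_succ, ratToReal_mixReverse, mixReverse, stepHead,
        show 2 * g - 1 - n = k + 1 by omega, schurM]
      field_simp
      ring
    rw [vec, show 2 * g - (n + 1 + 1) = k by omega, step_eq_pairVec (fun j hj => ih j (by omega))
      (by rw [hr]; exact hM') (by omega), hr, show 2 * g - (n + 1) = k + 1 by omega]
    simp only [hhead, pairVec]

/-! ### Identification of the `m_k` and of the products `R_n` -/

theorem mCoeff_two_mul (g : ℕ) (q : ℝ) : mCoeff g q (2 * g) = schurM g q 0 := if_pos rfl

theorem mCoeff_eq_schurM {g : ℕ} (hg : 0 < g) {q : ℝ} (hq : 1 < q) {n : ℕ} (hn : n ≤ 2 * g - 1) :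
    mCoeff g q (2 * g - (n + 1)) = schurM g q n := by
  rw [mCoeff, if_neg (by omega), show 2 * g - (2 * g - (n + 1)) - 1 = n by omega]
  cases n with
  | zero => rw [vec, zero_add, ratio_initVec hg hq]
  | succ n =>
    rw [show 2 * g - (n + 1 + 1) = 2 * g - 1 - (n + 1) by omega]
    exact ratio_of_pairVec_schurVec hn (vec_succ_eq_pairVec hg hq (by omega))

theorem ratioProd_zero (g : ℕ) (q : ℝ) : ratioProd g q 0 = 1 := by simp [ratioProd]

theorem ratioProd_one (g : ℕ) (q : ℝ) :
    ratioProd g q 1 = mCoeff g q (2 * g - 1) / mCoeff g q (2 * g) := by simp [ratioProd]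

theorem ratioProd_add_two (g : ℕ) (q : ℝ) (n : ℕ) : ratioProd g q (n + 2) =
    ratioProd g q n * (mCoeff g q (2 * g - (n + 2)) / mCoeff g q (2 * g - (n + 1))) := by
  rw [ratioProd, ratioProd]
  have hpar : Even (n + 2) ↔ Even n := by simp [Nat.even_add]
  by_cases h : Even n
  · rw [if_pos (hpar.2 h), if_pos h, show (n + 2) / 2 = n / 2 + 1 by omega,
      Finset.prod_range_succ, show 2 * (n / 2) = n from Nat.two_mul_div_two_of_even h]
  · rw [if_neg (mt hpar.1 h), if_neg h, show (n + 2) / 2 + 1 = n / 2 + 1 + 1 by omega,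
      Finset.prod_range_succ]
    have := Nat.two_mul_div_two_add_one_of_odd (Nat.not_even_iff_odd.1 h)
    rw [show 2 * (n / 2 + 1) + 1 = n + 2 by omega, show 2 * (n / 2 + 1) = n + 1 by omega]

theorem ratToReal_ratR {g : ℕ} (hg : 0 < g) {q : ℝ} (hq : 1 < q) (n : ℕ) (hn : n ≤ 2 * g) :
    ratToReal g (ratR g n) = ratioProd g q n := by
  induction n using Nat.strong_induction_on with
  | _ n ih =>
    match n with
    | 0 => rw [ratR, map_one, ratioProd_zero]
    | 1 =>
      rw [ratR, map_one, ratioProd_one, mCoeff_two_mul,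
        mCoeff_eq_schurM (n := 0) hg hq (by omega), div_self (schurM_ne_zero hg hq (by omega))]
    | n + 2 =>
      rw [ratR, map_mul, ih n (by omega) (by omega), ratioProd_add_two,
        mCoeff_eq_schurM (n := n + 1) hg hq (by omega), mCoeff_eq_schurM hg hq (by omega), schurM,
        mul_div_cancel_right₀ _ (schurM_ne_zero hg hq (by omega))]

end SelfReciprocal

theorem theorem2 (g : ℕ) (hg : 0 < g) :
    ∃ R : ℕ → SelfReciprocal.RatFun ℚ g,
      (∀ n : ℕ, n ≤ 2 * g → ∀ q : ℝ, 1 < q →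
        SelfReciprocal.ratToReal g (R n) = SelfReciprocal.ratioProd g q n) ∧
      ∀ c : Fin (g + 1) → ℝ, c 0 ≠ 0 →
        (SelfReciprocal.ZerosOnCircleSimple (SelfReciprocal.selfRecPoly g c) ↔
          ∀ n : ℕ, 1 ≤ n → n ≤ 2 * g →
            SelfReciprocal.PosAt (R n) c ∧ SelfReciprocal.PosAt (R n)⁻¹ c) :=
  ⟨SelfReciprocal.ratR g, fun n hn _ hq => SelfReciprocal.ratToReal_ratR hg hq n hn, fun c hc =>
    (SelfReciprocal.zerosOnCircleSimple_selfRecPoly_iff hg hc).trans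
      ((SelfReciprocal.forall_schurRatio_pos_iff hg hc).trans
        (SelfReciprocal.forall_posAt_ratR_iff hg c).symm)⟩
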